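/- Let $L^4$ be $\mathbb R^4$ with the scalar product $\langle X,Y\rangle=-X_0Y_0+X_1Y_1+X_2Y_2+X_3Y_3$ and $S_1^3=\{X\in L^4:\langle X,X\rangle=1\}$. Let $M$ be a connected smooth 2-dimensional manifold and $X:M\to S_1^3$ a smooth time-like immersed surface, i.e. the first fundamental form $\mathrm I=\langle dX,dX\rangle$ is Lorentzian. Let $N$ be a smooth unit normal field of $X$ in $S_1^3$, that is, $N:M\to L^4$ is smooth with $\langle N,N\rangle=1$, $\langle N,X\rangle=0$, $\langle N,dX\rangle=0$; regarded as a map $N:M\to S_1^3$ it is the generalized Gauss map of $X$. Put $\mathrm{II}=-\langle dX,dN\rangle$. On the open set $U_X=\{p\in M: X_0(p)\ne X_3(p)\}$ use the upper half-space model $(x_1,x_2,x_3)=\left(\frac{X_1}{|X_0-X_3|},\frac{X_2}{|X_0-X_3|},\frac1{|X_0-X_3|}\right)$ of $S_1^3$, with metric $x_3^{-2}(dx_1^2+dx_2^2-dx_3^2)$. Write the unit normal there as $\sum_A x_3\eta_A\,\partial/\partial x_A$. The normal Gauss map of $X$ (with unit normal $N$) is $\widetilde N=(\eta_1,\eta_2,\eta_3):U_X\to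 L^3$, the left translate of the unit normal to the identity $(0,0,1)$ for the group law $(a_1,a_2,a_3)\cdot(y_1,y_2,y_3)=(a_3y_1+a_1,\,a_3y_2+a_2,\,a_3y_3)$. The fourth fundamental form is $\mathrm{IV}=d\eta_1^2+d\eta_2^2-d\eta_3^2$. The normal Gauss map is called conformal if $\mathrm{IV}=\rho\,\mathrm{II}$ on $U_X$ for some smooth function $\rho$ on $U_X$. The same definitions apply to the surface $N$ with unit normal $X$, on $U_N=\{p\in M:N_0(p)\ne N_3(p)\}$. THEOREM 7.2. Suppose that $X$ has no umbilics (at no point is $\mathrm{II}$ a multiple of $\mathrm I$) and that the Gauss curvature $K$ of the induced metric $\mathrm I$ satisfies $K\neq1$ at every point of $M$. Then the generalized Gauss map $N:M\to S_1^3$ is itself a time-like immersed surface with unit normal field $X$, and the normal Gauss map of $X:M\to S_1^3$ is conformal if and only if the normal Gauss map of $N:M\to S_1^3$ is conformal. -/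

import Mathlib

open scoped Manifold ContDiff

namespace DeSitter

noncomputable section

/-- The underlying vector space of the Minkowski 4-space, with coordinates `X₀, X₁, X₂, X₃`. -/
abbrev L4 : Type := Fin 4 → ℝ

/-- The Minkowski scalar product `-X₀Y₀ + X₁Y₁ + X₂Y₂ + X₃Y₃`. -/
def mink (v w : L4) : ℝ := -(v 0 * w 0) + v 1 * w 1 + v 2 * w 2 + v 3 * w 3

/-- The scalar product `x₁y₁ + x₂y₂ - x₃y₃` of the Minkowski 3-space (indices shifted by one). -/
def mink3 (v w : Fin 3 → ℝ) : ℝ := v 0 * w 0 + v 1 * w 1 - v 2 * w 2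

/-- The upper half-space coordinates
`(X₁ / |X₀ - X₃|, X₂ / |X₀ - X₃|, 1 / |X₀ - X₃|)` of a point of the de Sitter space with
`X₀ ≠ X₃`; the de Sitter metric becomes `(dx₁² + dx₂² - dx₃²) / x₃²`. -/
def halfSpace (Y : L4) : Fin 3 → ℝ :=
  ![Y 1 / |Y 0 - Y 3|, Y 2 / |Y 0 - Y 3|, 1 / |Y 0 - Y 3|]

/-- The Lie group multiplication of the upper half-space `{x₃ > 0}`: the product of the matrices
`[[1, 0, 0, log x₃], [0, x₃, 0, x₁], [0, 0, x₃, x₂], [0, 0, 0, 1]]`. -/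
def groupMul (a y : Fin 3 → ℝ) : Fin 3 → ℝ :=
  ![a 2 * y 0 + a 0, a 2 * y 1 + a 1, a 2 * y 2]

/-- The inverse for `groupMul`, the identity being `(0, 0, 1)`. -/
def groupInv (a : Fin 3 → ℝ) : Fin 3 → ℝ :=
  ![-a 0 / a 2, -a 1 / a 2, 1 / a 2]

variable {M : Type*} [TopologicalSpace M] [ChartedSpace (EuclideanSpace ℝ (Fin 2)) M]

/-- The differential at `p` of a map from the surface `M` to the Minkowski 4-space. -/
def differential (X : M → L4) (p : M) : TangentSpace (𝓡 2) p →L[ℝ] L4 :=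
  mfderiv (𝓡 2) 𝓘(ℝ, L4) X p

/-- The first fundamental form `I = ⟨dX, dX⟩`. -/
def firstForm (X : M → L4) (p : M) (v w : TangentSpace (𝓡 2) p) : ℝ :=
  mink (differential X p v) (differential X p w)

/-- The second fundamental form `II = -⟨dX, dN⟩` with respect to the unit normal `N`. -/
def secondForm (X N : M → L4) (p : M) (v w : TangentSpace (𝓡 2) p) : ℝ :=
  -mink (differential X p v) (differential N p w)

/-- `X` is a time-like immersed surface in the de Sitter space `{⟨X, X⟩ = 1}`: a smooth immersion
whose induced metric is Lorentzian.  On a 2-dimensional space, having both a time-like and a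
space-like vector is the same as having signature `(1, 1)`. -/
structure IsTimelikeSurface (X : M → L4) : Prop where
  smooth : ContMDiff (𝓡 2) 𝓘(ℝ, L4) ∞ X
  mem_deSitter : ∀ p, mink (X p) (X p) = 1
  immersion : ∀ p, Function.Injective (differential X p)
  exists_timelike : ∀ p, ∃ v, firstForm X p v v < 0
  exists_spacelike : ∀ p, ∃ v, 0 < firstForm X p v v

/-- `N` is a smooth (space-like) unit normal field of the surface `X` in the de Sitter space,
translated to the origin of the Minkowski 4-space; that is, `N` is the generalized Gauss map
of `X`. -/
structure IsUnitNormal (X N : M → L4) : Prop where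
  smooth : ContMDiff (𝓡 2) 𝓘(ℝ, L4) ∞ N
  unit : ∀ p, mink (N p) (N p) = 1
  tangent_deSitter : ∀ p, mink (N p) (X p) = 0
  normal : ∀ p (v : TangentSpace (𝓡 2) p), mink (N p) (differential X p v) = 0

/-- `p` is an umbilic of the surface `X` with unit normal `N`: `II` is a multiple of `I` there. -/
def IsUmbilic (X N : M → L4) (p : M) : Prop :=
  ∃ c : ℝ, ∀ v w : TangentSpace (𝓡 2) p, secondForm X N p v w = c * firstForm X p v w

/-- The partial derivative `∂f/∂uᵢ`. -/
def pd {F : Type*} [NormedAddCommGroup F] [NormedSpace ℝ F] (i : Fin 2)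
    (f : EuclideanSpace ℝ (Fin 2) → F) (u : EuclideanSpace ℝ (Fin 2)) : F :=
  fderiv ℝ f u (EuclideanSpace.single i 1)

/-- The Christoffel symbol `Γᵏᵢⱼ` of the pseudo-Riemannian metric `g i j duᵢ duⱼ`. -/
def christoffel (g : EuclideanSpace ℝ (Fin 2) → Matrix (Fin 2) (Fin 2) ℝ)
    (k i j : Fin 2) (u : EuclideanSpace ℝ (Fin 2)) : ℝ :=
  ∑ l, (1 / 2) * (g u)⁻¹ k l *
    (pd i (fun x => g x j l) u + pd j (fun x => g x i l) u - pd l (fun x => g x i j) u)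

/-- The coefficient `Rˡ` of `R(∂₁, ∂₂)∂₂ = ∇₁∇₂∂₂ - ∇₂∇₁∂₂ = Rˡ ∂ₗ` (indices shifted by one). -/
def curvatureCoeff (g : EuclideanSpace ℝ (Fin 2) → Matrix (Fin 2) (Fin 2) ℝ)
    (l : Fin 2) (u : EuclideanSpace ℝ (Fin 2)) : ℝ :=
  pd 0 (christoffel g l 1 1) u - pd 1 (christoffel g l 0 1) u
    + ∑ m, (christoffel g m 1 1 u * christoffel g l 0 m u
      - christoffel g m 0 1 u * christoffel g l 1 m u)

/-- The (intrinsic) Gauss curvature `⟨R(∂₁, ∂₂)∂₂, ∂₁⟩ / (g₁₁ g₂₂ - g₁₂²)` of the metric `g`. -/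
def metricCurvature (g : EuclideanSpace ℝ (Fin 2) → Matrix (Fin 2) (Fin 2) ℝ)
    (u : EuclideanSpace ℝ (Fin 2)) : ℝ :=
  (∑ l, g u 0 l * curvatureCoeff g l u) / (g u).det

/-- The coefficients `gᵢⱼ = ⟨∂X/∂uᵢ, ∂X/∂uⱼ⟩` of the induced metric in the preferred chart
at `p`. -/
def inducedMetric (X : M → L4) (p : M) (u : EuclideanSpace ℝ (Fin 2)) :
    Matrix (Fin 2) (Fin 2) ℝ :=
  Matrix.of fun i j =>
    mink (pd i (X ∘ (chartAt (EuclideanSpace ℝ (Fin 2)) p).symm) u)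
      (pd j (X ∘ (chartAt (EuclideanSpace ℝ (Fin 2)) p).symm) u)

/-- The Gauss curvature at `p` of the metric induced on `M` by `X`. -/
def gaussCurvature (X : M → L4) (p : M) : ℝ :=
  metricCurvature (inducedMetric X p) (chartAt (EuclideanSpace ℝ (Fin 2)) p p)

/-- The open set on which the normal Gauss map of `X` is defined: the points mapped to the part
`X₀ ≠ X₃` of the de Sitter space, which is covered by the upper half-space model. -/
def gaussDomain (X : M → L4) : Set M := {p | X p 0 ≠ X p 3}

/-- The normal Gauss map `(η₁, η₂, η₃)` of the surface `X` with unit normal `N`, on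
`gaussDomain X`: the normal vector is carried to the upper half-space model and then left
translated from the point `x = halfSpace (X p)` to the identity of the group. -/
def normalGaussMap (X N : M → L4) (p : M) : Fin 3 → ℝ :=
  fderiv ℝ (groupMul (groupInv (halfSpace (X p)))) (halfSpace (X p))
    (fderiv ℝ halfSpace (X p) (N p))

/-- The differential of the normal Gauss map. -/
def normalGaussDifferential (X N : M → L4) (p : M) :
    TangentSpace (𝓡 2) p →L[ℝ] (Fin 3 → ℝ) :=
  mfderiv (𝓡 2) 𝓘(ℝ, Fin 3 → ℝ) (normalGaussMap X N) p

/-- The fourth fundamental form `IV = ⟨dÑ, dÑ⟩`, where `Ñ` is the normal Gauss map. -/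
def fourthForm (X N : M → L4) (p : M) (v w : TangentSpace (𝓡 2) p) : ℝ :=
  mink3 (normalGaussDifferential X N p v) (normalGaussDifferential X N p w)

/-- The normal Gauss map of `X` is conformal: `IV = ρ II` for a smooth function `ρ`, wherever the
normal Gauss map is defined. -/
def HasConformalNormalGaussMap (X N : M → L4) : Prop :=
  ∃ ρ : M → ℝ, ContMDiffOn (𝓡 2) 𝓘(ℝ, ℝ) ∞ ρ (gaussDomain X) ∧
    ∀ p ∈ gaussDomain X, ∀ v w : TangentSpace (𝓡 2) p,
      fourthForm X N p v w = ρ p * secondForm X N p v w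

end

end DeSitter

namespace DeSitter

/-! ### Linear algebra of the Minkowski product -/

/-! Write x = X₀ - X₃, n = N₀ - N₃, f = n / x and III = ⟨dN, dN⟩. The vector N - fX has equal 0th
and 3rd coordinates, and the normal Gauss map consists of its coordinates 1 and 2 together with -f.
Differentiating and using the orthogonality relations gives IV = III + 2f II + f² I
(`fourthForm_eq`), so x² IV = x² III + 2xn II + n² I. Exchanging X and N swaps x with n and I with
III and fixes II; hence x² IV_X = n² IV_N wherever both sides are defined, and IV_X = ρ II turns
into IV_N = (x/n)² ρ II.

The domains x ≠ 0 and n ≠ 0 may differ, and this is where umbilics enter. If IV_X = ρ II, then x²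
III + n² I is proportional to II where x ≠ 0. Such points accumulate at every point, since a
time-like plane does not lie in a null hyperplane. At a point with x = 0 ≠ n, continuity would make
I and II proportional: an umbilic (`gaussDomain_normal_subset`).

The Gauss equation K = 1 + det II / det I (`metricCurvature_patchMetric`) turns K ≠ 1 into
nonsingularity of II. So dN is injective with the same image as dX, namely {X, N}ᗮ; hence N is
time-like, and an umbilic of N would be one of X. All hypotheses used for the conformality argument
are then symmetric in X and N, and one implication suffices. -/

theorem mink_comm (v w : L4) : mink v w = mink w v := by
  simp only [mink]; ring

theorem mink_add_left (u v w : L4) : mink (u + v) w = mink u w + mink v w := by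
  simp only [mink, Pi.add_apply]; ring

theorem mink_smul_left (c : ℝ) (v w : L4) : mink (c • v) w = c * mink v w := by
  simp only [mink, Pi.smul_apply, smul_eq_mul]; ring

theorem mink_add_right (u v w : L4) : mink u (v + w) = mink u v + mink u w := by
  simp only [mink, Pi.add_apply]; ring

theorem mink_smul_right (c : ℝ) (v w : L4) : mink v (c • w) = c * mink v w := by
  simp only [mink, Pi.smul_apply, smul_eq_mul]; ring

theorem mink_zero_left (v : L4) : mink 0 v = 0 := by simp [mink]

/-- Two vectors with nonsingular Gram matrix, completed by an orthonormal pair of space-like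
vectors orthogonal to them, span the Minkowski 4-space. -/
theorem exists_mink_expansion {a b n x : L4}
    (hdet : mink a a * mink b b - mink a b ^ 2 ≠ 0)
    (hnn : mink n n = 1) (hxx : mink x x = 1) (hnx : mink n x = 0)
    (hna : mink n a = 0) (hnb : mink n b = 0) (hxa : mink x a = 0) (hxb : mink x b = 0)
    (y : L4) :
    ∃ s t : ℝ, y = s • a + t • b + mink y n • n + mink y x • x := by
  have hli : LinearIndependent ℝ ![a, b, n, x] := by
    rw [Fintype.linearIndependent_iff]
    intro c hc
    simp only [Fin.sum_univ_four, Matrix.cons_val] at hc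
    -- Pairing with `a` and `b` leaves a linear system with the Gram matrix, solved by Cramer's
    -- rule; pairing with `n` and `x` isolates the other two coefficients.
    have key : ∀ z, c 0 * mink a z + c 1 * mink b z + c 2 * mink n z + c 3 * mink x z = 0 := by
      intro z
      have := congrArg (fun y => mink y z) hc
      simpa only [mink_add_left, mink_smul_left, mink_zero_left] using this
    have ka := key a
    have kb := key b
    have kn := key n
    have kx := key x
    rw [mink_comm b a, hna, hxa] at ka
    rw [hnb, hxb] at kb
    rw [mink_comm a n, mink_comm b n, hna, hnb, hnn, mink_comm x n, hnx] at kn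
    rw [mink_comm a x, mink_comm b x, hxa, hxb, hxx, hnx] at kx
    have h0 : c 0 = 0 := by
      refine (mul_eq_zero.mp (?_ : c 0 * (mink a a * mink b b - mink a b ^ 2) = 0)).resolve_right
        hdet
      linear_combination mink b b * ka - mink a b * kb
    have h1 : c 1 = 0 := by
      refine (mul_eq_zero.mp (?_ : c 1 * (mink a a * mink b b - mink a b ^ 2) = 0)).resolve_right
        hdet
      linear_combination mink a a * kb - mink a b * ka
    intro i
    fin_cases i
    · exact h0
    · exact h1
    · simpa using kn
    · simpa using kx
  have hspan := hli.span_eq_top_of_card_eq_finrank (by simp)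
  have hy : y ∈ Submodule.span ℝ (Set.range ![a, b, n, x]) := by rw [hspan]; trivial
  obtain ⟨c, hc⟩ := (Submodule.mem_span_range_iff_exists_fun ℝ).mp hy
  simp only [Fin.sum_univ_four, Matrix.cons_val] at hc
  have key : ∀ z, c 0 * mink a z + c 1 * mink b z + c 2 * mink n z + c 3 * mink x z
      = mink y z := by
    intro z
    rw [← hc]
    simp only [mink_add_left, mink_smul_left]
  have kn := key n
  have kx := key x
  rw [mink_comm a n, mink_comm b n, hna, hnb, hnn, mink_comm x n, hnx] at kn
  rw [mink_comm a x, mink_comm b x, hxa, hxb, hxx, hnx] at kx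
  refine ⟨c 0, c 1, ?_⟩
  rw [← kn, ← kx]
  simpa using hc.symm

/-- A binary quadratic form taking both signs has negative discriminant. -/
theorem disc_neg_of_indefinite {p q r : ℝ} {s t s' t' : ℝ}
    (hneg : s ^ 2 * p + 2 * s * t * q + t ^ 2 * r < 0)
    (hpos : 0 < s' ^ 2 * p + 2 * s' * t' * q + t' ^ 2 * r) : p * r - q ^ 2 < 0 := by
  by_contra! h
  -- With nonnegative discriminant, completing the square shows that p times the form is
  -- nonnegative, so the form never has the sign opposite to p. If p = 0, then q = 0 and the form is
  -- t²r.
  rcases lt_trichotomy p 0 with hp | hp | hp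
  · have : p * (s' ^ 2 * p + 2 * s' * t' * q + t' ^ 2 * r)
        = (s' * p + t' * q) ^ 2 + t' ^ 2 * (p * r - q ^ 2) := by ring
    nlinarith [sq_nonneg (s' * p + t' * q), mul_nonneg (sq_nonneg t') h]
  · subst hp
    have hq : q = 0 := by nlinarith
    subst hq
    have h1 : 0 < -r := by
      by_contra! h'
      nlinarith [sq_nonneg t]
    nlinarith [sq_nonneg t']
  · have : p * (s ^ 2 * p + 2 * s * t * q + t ^ 2 * r)
        = (s * p + t * q) ^ 2 + t ^ 2 * (p * r - q ^ 2) := by ring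
    nlinarith [sq_nonneg (s * p + t * q), mul_nonneg (sq_nonneg t) h]

theorem euclidean_two_eq (v : EuclideanSpace ℝ (Fin 2)) :
    v = v 0 • EuclideanSpace.single 0 1 + v 1 • EuclideanSpace.single 1 1 := by
  ext i
  fin_cases i <;> simp

theorem map_euclidean_two {F : Type*} [AddCommGroup F] [Module ℝ F]
    (a : EuclideanSpace ℝ (Fin 2) →ₗ[ℝ] F) (v : EuclideanSpace ℝ (Fin 2)) :
    a v = v 0 • a (EuclideanSpace.single 0 1) + v 1 • a (EuclideanSpace.single 1 1) := by
  conv_lhs => rw [euclidean_two_eq v]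
  simp only [map_add, map_smul]

theorem mink_map_map (a b : EuclideanSpace ℝ (Fin 2) →ₗ[ℝ] L4)
    (v w : EuclideanSpace ℝ (Fin 2)) :
    mink (a v) (b w) =
      v 0 * w 0 * mink (a (EuclideanSpace.single 0 1)) (b (EuclideanSpace.single 0 1)) +
      v 0 * w 1 * mink (a (EuclideanSpace.single 0 1)) (b (EuclideanSpace.single 1 1)) +
      v 1 * w 0 * mink (a (EuclideanSpace.single 1 1)) (b (EuclideanSpace.single 0 1)) +
      v 1 * w 1 * mink (a (EuclideanSpace.single 1 1)) (b (EuclideanSpace.single 1 1)) := by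
  rw [map_euclidean_two a v, map_euclidean_two b w]
  simp only [mink_add_left, mink_add_right, mink_smul_left, mink_smul_right]
  ring

/-! ### Pairs of linear maps from the plane, modelling `dX` and `dN` at a point -/

section Plane

variable {a b : EuclideanSpace ℝ (Fin 2) →ₗ[ℝ] L4}

/-- Converts the Lorentzian condition, given by two vectors, into the nonzero Gram determinant
needed for expansions in a frame and for inverting the metric. -/
theorem gram_neg_of_indefinite (hneg : ∃ v, mink (a v) (a v) < 0)
    (hpos : ∃ v, 0 < mink (a v) (a v)) :
    mink (a (EuclideanSpace.single 0 1)) (a (EuclideanSpace.single 0 1)) *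
      mink (a (EuclideanSpace.single 1 1)) (a (EuclideanSpace.single 1 1)) -
      mink (a (EuclideanSpace.single 0 1)) (a (EuclideanSpace.single 1 1)) ^ 2 < 0 := by
  obtain ⟨v, hv⟩ := hneg
  obtain ⟨w, hw⟩ := hpos
  rw [mink_map_map] at hv hw
  rw [mink_comm (a (EuclideanSpace.single 1 1)) (a (EuclideanSpace.single 0 1))] at hv hw
  refine disc_neg_of_indefinite (s := v 0) (t := v 1) (s' := w 0) (t' := w 1) ?_ ?_
  · linarith
  · linarith

/-- A map of a plane into the orthogonal complement of an orthonormal pair `x, n` whose mixed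
Gram determinant with the Lorentzian plane `{x, n}ᗮ = range a` is nonzero is injective with the
same range. -/
theorem injective_and_range_eq {x n : L4} (hxx : mink x x = 1) (hnn : mink n n = 1)
    (hnx : mink n x = 0) (hna : ∀ v, mink n (a v) = 0) (hxa : ∀ v, mink x (a v) = 0)
    (hnb : ∀ v, mink n (b v) = 0) (hxb : ∀ v, mink x (b v) = 0)
    (ha : Function.Injective a)
    (hneg : ∃ v, mink (a v) (a v) < 0) (hpos : ∃ v, 0 < mink (a v) (a v))
    (hdet : mink (a (EuclideanSpace.single 0 1)) (b (EuclideanSpace.single 0 1)) *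
      mink (a (EuclideanSpace.single 1 1)) (b (EuclideanSpace.single 1 1)) -
      mink (a (EuclideanSpace.single 0 1)) (b (EuclideanSpace.single 1 1)) *
      mink (a (EuclideanSpace.single 1 1)) (b (EuclideanSpace.single 0 1)) ≠ 0) :
    Function.Injective b ∧ LinearMap.range b = LinearMap.range a := by
  have hb : Function.Injective b := by
    refine (injective_iff_map_eq_zero b).mpr fun v hv => ?_
    have key : ∀ z, v 0 * mink z (b (EuclideanSpace.single 0 1)) +
        v 1 * mink z (b (EuclideanSpace.single 1 1)) = 0 := by
      intro z
      rw [← mink_smul_right, ← mink_smul_right, ← mink_add_right, ← map_euclidean_two, hv,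
        mink_comm, mink_zero_left]
    have k0 := key (a (EuclideanSpace.single 0 1))
    have k1 := key (a (EuclideanSpace.single 1 1))
    have h0 : v 0 = 0 := by
      refine (mul_eq_zero.mp ?_).resolve_right hdet
      linear_combination mink (a (EuclideanSpace.single 1 1)) (b (EuclideanSpace.single 1 1)) * k0
        - mink (a (EuclideanSpace.single 0 1)) (b (EuclideanSpace.single 1 1)) * k1
    have h1 : v 1 = 0 := by
      refine (mul_eq_zero.mp ?_).resolve_right hdet
      linear_combination mink (a (EuclideanSpace.single 0 1)) (b (EuclideanSpace.single 0 1)) * k1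
        - mink (a (EuclideanSpace.single 1 1)) (b (EuclideanSpace.single 0 1)) * k0
    rw [euclidean_two_eq v, h0, h1]
    simp
  refine ⟨hb, Submodule.eq_of_le_of_finrank_eq ?_ ?_⟩
  · rintro _ ⟨v, rfl⟩
    -- The `n` and `x` coefficients of `b v` vanish by orthogonality, so `b v` lies in the range of
    -- `a`; equality of ranges follows by dimension.
    obtain ⟨s, t, h⟩ := exists_mink_expansion (gram_neg_of_indefinite hneg hpos).ne hnn hxx hnx
      (hna _) (hna _) (hxa _) (hxa _) (b v)
    rw [mink_comm, hnb, mink_comm, hxb, zero_smul, zero_smul, add_zero, add_zero, ← map_smul,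
      ← map_smul, ← map_add] at h
    exact ⟨_, h.symm⟩
  · rw [LinearMap.finrank_range_of_inj hb, LinearMap.finrank_range_of_inj ha]

/-- If the second form is proportional to the third, it is proportional to the first. -/
theorem proportional_of_range_eq (hr : LinearMap.range b = LinearMap.range a)
    (hneg : ∃ v, mink (a v) (a v) < 0) {c : ℝ}
    (hc : ∀ v w, -mink (b v) (a w) = c * mink (b v) (b w)) :
    ∃ c' : ℝ, ∀ v w, -mink (a v) (b w) = c' * mink (a v) (a w) := by
  -- The first slot of `hc` runs over the whole common range, so `b v` may be replaced there by `a
  -- v`. This turns II = c III into I = c II.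
  have key : ∀ v w, mink (a v) (a w) = c * -mink (a v) (b w) := by
    intro v w
    obtain ⟨v', hv'⟩ : a v ∈ LinearMap.range b := hr ▸ ⟨v, rfl⟩
    rw [← hv']
    linarith [hc v' w]
  have hc0 : c ≠ 0 := by
    rintro rfl
    obtain ⟨v, hv⟩ := hneg
    rw [key v v] at hv
    simp at hv
  exact ⟨c⁻¹, fun v w => by rw [key v w]; field_simp⟩

end Plane

end DeSitter

namespace DeSitter

open Filter Topology

/-! ### Partial derivatives and the Gauss equation in a coordinate patch -/

section Calculus

variable {F : Type*} [NormedAddCommGroup F] [NormedSpace ℝ F]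

theorem contDiffAt_pd {f : EuclideanSpace ℝ (Fin 2) → F} {u : EuclideanSpace ℝ (Fin 2)}
    (hf : ContDiffAt ℝ ∞ f u) (i : Fin 2) : ContDiffAt ℝ ∞ (pd i f) u :=
  (hf.fderiv_right (m := ∞) (by simp)).clm_apply contDiffAt_const

theorem eventually_contDiffAt_two {f : EuclideanSpace ℝ (Fin 2) → F}
    {u : EuclideanSpace ℝ (Fin 2)} (hf : ContDiffAt ℝ ∞ f u) :
    ∀ᶠ x in 𝓝 u, ContDiffAt ℝ 2 f x :=
  (hf.of_le (ENat.LEInfty.out : (2 : WithTop ℕ∞) ≤ ∞)).eventually (by simp)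

theorem pd_comm {f : EuclideanSpace ℝ (Fin 2) → F} {u : EuclideanSpace ℝ (Fin 2)}
    (hf : ContDiffAt ℝ 2 f u) (i j : Fin 2) : pd i (pd j f) u = pd j (pd i f) u := by
  have hd : DifferentiableAt ℝ (fderiv ℝ f) u :=
    (hf.fderiv_right (m := 1) (by norm_num)).differentiableAt (by simp)
  have key : ∀ i j : Fin 2, pd i (pd j f) u =
      fderiv ℝ (fderiv ℝ f) u (EuclideanSpace.single i 1) (EuclideanSpace.single j 1) := by
    intro i j
    have : pd j f = fun x => fderiv ℝ f x (EuclideanSpace.single j 1) := rfl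
    rw [this, pd, fderiv_clm_apply hd (by fun_prop)]
    simp
  rw [key, key]
  exact hf.isSymmSndFDerivAt (by simp) _ _

theorem pd_congr {f g : EuclideanSpace ℝ (Fin 2) → F} {u : EuclideanSpace ℝ (Fin 2)}
    (h : f =ᶠ[𝓝 u] g) (i : Fin 2) : pd i f u = pd i g u := by
  rw [pd, pd, h.fderiv_eq]

theorem pd_const (c : F) (u : EuclideanSpace ℝ (Fin 2)) (i : Fin 2) :
    pd i (fun _ => c) u = 0 := by
  simp [pd]

theorem pd_add {f g : EuclideanSpace ℝ (Fin 2) → ℝ} {u : EuclideanSpace ℝ (Fin 2)}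
    (hf : DifferentiableAt ℝ f u) (hg : DifferentiableAt ℝ g u) (i : Fin 2) :
    pd i (fun x => f x + g x) u = pd i f u + pd i g u := by
  simp [pd, fderiv_fun_add hf hg]

theorem pd_mul {f g : EuclideanSpace ℝ (Fin 2) → ℝ} {u : EuclideanSpace ℝ (Fin 2)}
    (hf : DifferentiableAt ℝ f u) (hg : DifferentiableAt ℝ g u) (i : Fin 2) :
    pd i (fun x => f x * g x) u = pd i f u * g u + f u * pd i g u := by
  simp [pd, fderiv_fun_mul hf hg]; ring

theorem pd_mink {f g : EuclideanSpace ℝ (Fin 2) → L4} {u : EuclideanSpace ℝ (Fin 2)}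
    (hf : DifferentiableAt ℝ f u) (hg : DifferentiableAt ℝ g u) (i : Fin 2) :
    pd i (fun x => mink (f x) (g x)) u = mink (pd i f u) (g u) + mink (f u) (pd i g u) := by
  have hf' := hasFDerivAt_pi'.mp hf.hasFDerivAt
  have hg' := hasFDerivAt_pi'.mp hg.hasFDerivAt
  have h := ((((hf' 0).mul (hg' 0)).neg.add ((hf' 1).mul (hg' 1))).add
    ((hf' 2).mul (hg' 2))).add ((hf' 3).mul (hg' 3))
  have h2 : HasFDerivAt (fun x => mink (f x) (g x)) _ u := h
  rw [pd, h2.fderiv]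
  simp [mink, pd]
  ring

theorem contDiffAt_mink {n : WithTop ℕ∞} {f g : F → L4} {u : F}
    (hf : ContDiffAt ℝ n f u) (hg : ContDiffAt ℝ n g u) :
    ContDiffAt ℝ n (fun x => mink (f x) (g x)) u := by
  have hf' := contDiffAt_pi.mp hf
  have hg' := contDiffAt_pi.mp hg
  exact ((((hf' 0).mul (hg' 0)).neg.add ((hf' 1).mul (hg' 1))).add
    ((hf' 2).mul (hg' 2))).add ((hf' 3).mul (hg' 3))

end Calculus

/-- The metric induced by a coordinate patch. -/
noncomputable def patchMetric (X : EuclideanSpace ℝ (Fin 2) → L4) (u : EuclideanSpace ℝ (Fin 2)) :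
    Matrix (Fin 2) (Fin 2) ℝ :=
  Matrix.of fun i j => mink (pd i X u) (pd j X u)

/-! ### Christoffel symbols of an induced metric and the Gauss equation -/

section Patch

variable {X N : EuclideanSpace ℝ (Fin 2) → L4} {u : EuclideanSpace ℝ (Fin 2)}

theorem mink_pd_self_eq_zero (hX : DifferentiableAt ℝ X u)
    (hXX : ∀ᶠ x in 𝓝 u, mink (X x) (X x) = 1) (i : Fin 2) : mink (X u) (pd i X u) = 0 := by
  have h := pd_congr (g := fun _ => (1 : ℝ)) hXX i
  rw [pd_mink hX hX, pd_const, mink_comm (pd i X u)] at h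
  linarith

/-- Derivative of ⟨N, ∂ⱼX⟩ = 0. Besides the normal field, it is applied with `X` itself in place of
`N`, giving ⟨X, ∂ᵢ∂ⱼX⟩ = -gᵢⱼ. -/
theorem mink_pd_pd_add (hN : DifferentiableAt ℝ N u) (hX : ContDiffAt ℝ ∞ X u)
    (h : ∀ᶠ x in 𝓝 u, ∀ i, mink (N x) (pd i X x) = 0) (i j : Fin 2) :
    mink (pd i N u) (pd j X u) + mink (N u) (pd i (pd j X) u) = 0 := by
  have h' := pd_congr (g := fun _ => (0 : ℝ)) (h.mono fun x hx => hx j) i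
  rwa [pd_mink hN ((contDiffAt_pd hX j).differentiableAt (by simp)), pd_const] at h'

/-- Expanding the three metric derivatives by the product rule, all terms cancel by symmetry of
second derivatives except 2⟨∂ᵢ∂ⱼX, ∂ₗX⟩. -/
theorem christoffel_patchMetric (hX : ContDiffAt ℝ 2 X u) (k i j : Fin 2) :
    christoffel (patchMetric X) k i j u =
      ∑ l, (patchMetric X u)⁻¹ k l * mink (pd i (pd j X) u) (pd l X u) := by
  have hd : ∀ i, DifferentiableAt ℝ (pd i X) u := fun i =>
    ((hX.fderiv_right (m := 1) (by norm_num)).clm_apply contDiffAt_const).differentiableAt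
      (by simp)
  have hp : ∀ i j l : Fin 2, pd l (fun x => patchMetric X x i j) u =
      mink (pd l (pd i X) u) (pd j X u) + mink (pd i X u) (pd l (pd j X) u) :=
    fun i j l => pd_mink (hd i) (hd j) l
  refine Finset.sum_congr rfl fun l _ => ?_
  rw [hp, hp, hp, pd_comm hX l i, pd_comm hX l j, pd_comm hX j i,
    mink_comm (pd j X u), mink_comm (pd i X u)]
  ring

/-- Lowering the index removes the inverse metric, so the curvature can be computed without ever
differentiating g⁻¹ explicitly. -/
theorem sum_patchMetric_mul_christoffel (hX : ContDiffAt ℝ 2 X u)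
    (hdet : (patchMetric X u).det ≠ 0) (l i j : Fin 2) :
    patchMetric X u l 0 * christoffel (patchMetric X) 0 i j u +
      patchMetric X u l 1 * christoffel (patchMetric X) 1 i j u =
      mink (pd i (pd j X) u) (pd l X u) := by
  have hinv : patchMetric X u * (patchMetric X u)⁻¹ = 1 :=
    Matrix.mul_nonsing_inv _ (isUnit_iff_ne_zero.mpr hdet)
  have key : ∀ m, patchMetric X u l 0 * (patchMetric X u)⁻¹ 0 m +
      patchMetric X u l 1 * (patchMetric X u)⁻¹ 1 m = (1 : Matrix (Fin 2) (Fin 2) ℝ) l m := by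
    intro m
    rw [← hinv, Matrix.mul_apply, Fin.sum_univ_two]
  rw [christoffel_patchMetric hX, christoffel_patchMetric hX, Fin.sum_univ_two, Fin.sum_univ_two]
  have k0 := key 0
  have k1 := key 1
  have hsum : mink (pd i (pd j X) u) (pd l X u) =
      (1 : Matrix (Fin 2) (Fin 2) ℝ) l 0 * mink (pd i (pd j X) u) (pd 0 X u) +
      (1 : Matrix (Fin 2) (Fin 2) ℝ) l 1 * mink (pd i (pd j X) u) (pd 1 X u) := by
    obtain rfl | rfl : l = 0 ∨ l = 1 := by omega
    all_goals simp
  rw [hsum]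
  linear_combination mink (pd i (pd j X) u) (pd 0 X u) * k0 +
    mink (pd i (pd j X) u) (pd 1 X u) * k1

theorem contDiffAt_patchMetric (hX : ContDiffAt ℝ ∞ X u) (i j : Fin 2) :
    ContDiffAt ℝ ∞ (fun x => patchMetric X x i j) u :=
  contDiffAt_mink (contDiffAt_pd hX i) (contDiffAt_pd hX j)

theorem contDiffAt_det_patchMetric (hX : ContDiffAt ℝ ∞ X u) :
    ContDiffAt ℝ ∞ (fun x => (patchMetric X x).det) u := by
  simp only [Matrix.det_fin_two]
  exact ((contDiffAt_patchMetric hX 0 0).mul (contDiffAt_patchMetric hX 1 1)).sub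
    ((contDiffAt_patchMetric hX 0 1).mul (contDiffAt_patchMetric hX 1 0))

theorem contDiffAt_inv_patchMetric (hX : ContDiffAt ℝ ∞ X u)
    (hdet : (patchMetric X u).det ≠ 0) (i j : Fin 2) :
    ContDiffAt ℝ ∞ (fun x => (patchMetric X x)⁻¹ i j) u := by
  have h : ∀ x, (patchMetric X x)⁻¹ i j =
      (patchMetric X x).det⁻¹ * (patchMetric X x).adjugate i j := by
    intro x
    rw [Matrix.inv_def, Ring.inverse_eq_inv', Matrix.smul_apply, smul_eq_mul]
  simp only [h, Matrix.adjugate_fin_two]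
  refine ((contDiffAt_det_patchMetric hX).inv hdet).mul ?_
  fin_cases i <;> fin_cases j
  · exact contDiffAt_patchMetric hX 1 1
  · exact (contDiffAt_patchMetric hX 0 1).neg
  · exact (contDiffAt_patchMetric hX 1 0).neg
  · exact contDiffAt_patchMetric hX 0 0

theorem differentiableAt_christoffel (hX : ContDiffAt ℝ ∞ X u)
    (hdet : (patchMetric X u).det ≠ 0) (k i j : Fin 2) :
    DifferentiableAt ℝ (christoffel (patchMetric X) k i j) u := by
  have h : (christoffel (patchMetric X) k i j) =ᶠ[𝓝 u] fun x =>
      ∑ l, (patchMetric X x)⁻¹ k l * mink (pd i (pd j X) x) (pd l X x) :=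
    (eventually_contDiffAt_two hX).mono fun x hx => christoffel_patchMetric hx k i j
  refine DifferentiableAt.congr_of_eventuallyEq ?_ h
  refine DifferentiableAt.fun_sum fun l _ => ContDiffAt.differentiableAt (n := ∞) ?_ (by simp)
  exact (contDiffAt_inv_patchMetric hX hdet k l).mul
    (contDiffAt_mink (contDiffAt_pd (contDiffAt_pd hX j) i) (contDiffAt_pd hX l))

/-- The derivative of the Christoffel symbols of the first kind. -/
theorem sum_pd_christoffel (hX : ContDiffAt ℝ ∞ X u)
    (hdet : (patchMetric X u).det ≠ 0) (m l i j : Fin 2) :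
    (mink (pd m (pd l X) u) (pd 0 X u) + mink (pd l X u) (pd m (pd 0 X) u)) *
        christoffel (patchMetric X) 0 i j u +
      patchMetric X u l 0 * pd m (christoffel (patchMetric X) 0 i j) u +
      ((mink (pd m (pd l X) u) (pd 1 X u) + mink (pd l X u) (pd m (pd 1 X) u)) *
        christoffel (patchMetric X) 1 i j u +
      patchMetric X u l 1 * pd m (christoffel (patchMetric X) 1 i j) u) =
      mink (pd m (pd i (pd j X)) u) (pd l X u) + mink (pd i (pd j X) u) (pd m (pd l X) u) := by
  -- The identity must hold on a neighbourhood to be differentiated; nonvanishing of the determinant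
  -- is an open condition.
  have hev : (fun x => patchMetric X x l 0 * christoffel (patchMetric X) 0 i j x +
      patchMetric X x l 1 * christoffel (patchMetric X) 1 i j x) =ᶠ[𝓝 u]
      fun x => mink (pd i (pd j X) x) (pd l X x) := by
    filter_upwards [(eventually_contDiffAt_two hX),
      (contDiffAt_det_patchMetric hX).continuousAt.eventually_ne hdet] with x hx hx'
    exact sum_patchMetric_mul_christoffel hx hx' l i j
  have hd : ∀ i, DifferentiableAt ℝ (pd i X) u := fun i =>
    (contDiffAt_pd hX i).differentiableAt (by simp)
  have hp : ∀ i j l : Fin 2, pd l (fun x => patchMetric X x i j) u =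
      mink (pd l (pd i X) u) (pd j X u) + mink (pd i X u) (pd l (pd j X) u) :=
    fun i j l => pd_mink (hd i) (hd j) l
  have hg : ∀ i j, DifferentiableAt ℝ (fun x => patchMetric X x i j) u := fun i j =>
    (contDiffAt_patchMetric hX i j).differentiableAt (by simp)
  have hc := fun k => differentiableAt_christoffel hX hdet k i j
  have h := pd_congr hev m
  rw [pd_add ((hg l 0).fun_mul (hc 0)) ((hg l 1).fun_mul (hc 1)), pd_mul (hg l 0) (hc 0),
    pd_mul (hg l 1) (hc 1), hp, hp,
    pd_mink ((contDiffAt_pd (contDiffAt_pd hX j) i).differentiableAt (by simp)) (hd l)] at h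
  exact h

/-- The Gauss formula, paired with an arbitrary vector. -/
theorem mink_pd_pd_eq (hX : ContDiffAt ℝ ∞ X u) (hXX : ∀ᶠ x in 𝓝 u, mink (X x) (X x) = 1)
    (hNN : mink (N u) (N u) = 1) (hNX : mink (N u) (X u) = 0)
    (hNd : ∀ i, mink (N u) (pd i X u) = 0)
    (hdet : (patchMetric X u).det ≠ 0) (i j : Fin 2) (z : L4) :
    mink (pd i (pd j X) u) z =
      christoffel (patchMetric X) 0 i j u * mink (pd 0 X u) z +
      christoffel (patchMetric X) 1 i j u * mink (pd 1 X u) z +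
      mink (pd i (pd j X) u) (N u) * mink (N u) z - patchMetric X u i j * mink (X u) z := by
  have hX2 : ContDiffAt ℝ 2 X u := (eventually_contDiffAt_two hX).self_of_nhds
  have hXd : ∀ᶠ x in 𝓝 u, ∀ i, mink (X x) (pd i X x) = 0 := by
    filter_upwards [hXX.eventually_nhds, (eventually_contDiffAt_two hX)] with x hx hx' i
    exact mink_pd_self_eq_zero (hx'.differentiableAt (by simp)) hx i
  have hXij : mink (pd i (pd j X) u) (X u) = -patchMetric X u i j := by
    have h : mink (pd i X u) (pd j X u) + mink (X u) (pd i (pd j X) u) = 0 :=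
      mink_pd_pd_add (hX.differentiableAt (by simp)) hX hXd i j
    rw [mink_comm, patchMetric, Matrix.of_apply]
    linarith
  have hXd' := hXd.self_of_nhds
  have hgdet : mink (pd 0 X u) (pd 0 X u) * mink (pd 1 X u) (pd 1 X u) -
      mink (pd 0 X u) (pd 1 X u) ^ 2 ≠ 0 := by
    rw [Matrix.det_fin_two] at hdet
    simp only [patchMetric, Matrix.of_apply] at hdet
    rw [mink_comm (pd 1 X u) (pd 0 X u)] at hdet
    rwa [sq]
  obtain ⟨s, t, h⟩ := exists_mink_expansion hgdet hNN hXX.self_of_nhds hNX (hNd 0) (hNd 1)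
    (hXd' 0) (hXd' 1) (pd i (pd j X) u)
  have key : ∀ z, mink (pd i (pd j X) u) z = s * mink (pd 0 X u) z + t * mink (pd 1 X u) z +
      mink (pd i (pd j X) u) (N u) * mink (N u) z - patchMetric X u i j * mink (X u) z := by
    intro z
    have h' := congrArg (fun y => mink y z) h
    simp only [mink_add_left, mink_smul_left, hXij] at h'
    linarith
  have k0 := key (pd 0 X u)
  have k1 := key (pd 1 X u)
  have c0 := sum_patchMetric_mul_christoffel hX2 hdet 0 i j
  have c1 := sum_patchMetric_mul_christoffel hX2 hdet 1 i j
  simp only [hNd, hXd', mul_zero, add_zero, sub_zero] at k0 k1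
  simp only [patchMetric, Matrix.of_apply] at c0 c1
  rw [mink_comm (pd 1 X u) (pd 0 X u)] at k0 c1
  -- The Christoffel symbols and (s, t) solve the same Gram system, so they agree by Cramer's rule.
  have hs : christoffel (patchMetric X) 0 i j u = s := by
    refine sub_eq_zero.mp ((mul_eq_zero.mp ?_).resolve_left hgdet)
    linear_combination (exp := 1) mink (pd 1 X u) (pd 1 X u) * (c0 + k0) -
      mink (pd 0 X u) (pd 1 X u) * (c1 + k1)
  have ht : christoffel (patchMetric X) 1 i j u = t := by
    refine sub_eq_zero.mp ((mul_eq_zero.mp ?_).resolve_left hgdet)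
    linear_combination (exp := 1) mink (pd 0 X u) (pd 0 X u) * (c1 + k1) -
      mink (pd 0 X u) (pd 1 X u) * (c0 + k0)
  rw [hs, ht]
  exact key z

/-- The Gauss equation `K = 1 + det II / det I`. -/
theorem metricCurvature_patchMetric (hX : ContDiffAt ℝ ∞ X u)
    (hXX : ∀ᶠ x in 𝓝 u, mink (X x) (X x) = 1)
    (hNN : mink (N u) (N u) = 1) (hNX : mink (N u) (X u) = 0)
    (hNd : ∀ i, mink (N u) (pd i X u) = 0) (hdet : (patchMetric X u).det ≠ 0) :
    metricCurvature (patchMetric X) u = 1 +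
      (mink (pd 0 (pd 0 X) u) (N u) * mink (pd 1 (pd 1 X) u) (N u) -
        mink (pd 0 (pd 1 X) u) (N u) ^ 2) / (patchMetric X u).det := by
  have hX2 : ContDiffAt ℝ 2 X u := (eventually_contDiffAt_two hX).self_of_nhds
  have hXd : ∀ᶠ x in 𝓝 u, ∀ i, mink (X x) (pd i X x) = 0 := by
    filter_upwards [hXX.eventually_nhds, (eventually_contDiffAt_two hX)] with x hx hx' i
    exact mink_pd_self_eq_zero (hx'.differentiableAt (by simp)) hx i
  have hXij : ∀ i j, mink (X u) (pd i (pd j X) u) = -patchMetric X u i j := by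
    intro i j
    have h : mink (pd i X u) (pd j X u) + mink (X u) (pd i (pd j X) u) = 0 :=
      mink_pd_pd_add (hX.differentiableAt (by simp)) hX hXd i j
    rw [patchMetric, Matrix.of_apply]
    linarith
  have hc := sum_patchMetric_mul_christoffel hX2 hdet
  -- These are ∂₀⟨∂₁∂₁X, ∂₀X⟩ and ∂₁⟨∂₀∂₁X, ∂₀X⟩, indices counted from 0. In their difference the
  -- third derivatives cancel, leaving ⟨∂₁∂₁X, ∂₀∂₀X⟩ - ⟨∂₀∂₁X, ∂₀∂₁X⟩.
  have e1 := sum_pd_christoffel hX hdet 0 0 1 1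
  have e2 := sum_pd_christoffel hX hdet 1 0 0 1
  -- The Gauss formula splits these two products: the N-parts yield det II, the X-parts yield det I
  -- (the ambient curvature 1), and the tangential parts match the quadratic Christoffel terms.
  have g1 := mink_pd_pd_eq hX hXX hNN hNX hNd hdet 1 1 (pd 0 (pd 0 X) u)
  have g2 := mink_pd_pd_eq hX hXX hNN hNX hNd hdet 0 1 (pd 0 (pd 1 X) u)
  rw [hXij, mink_comm (N u)] at g1 g2
  have hs3 : pd 0 (pd 1 (pd 1 X)) u = pd 1 (pd 0 (pd 1 X)) u :=
    pd_comm (eventually_contDiffAt_two (contDiffAt_pd hX 1)).self_of_nhds 0 1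
  have hs2 : pd 1 (pd 0 X) u = pd 0 (pd 1 X) u := pd_comm hX2 1 0
  have hgs : patchMetric X u 1 0 = patchMetric X u 0 1 := mink_comm _ _
  rw [metricCurvature, div_eq_iff hdet, add_mul, div_mul_cancel₀ _ hdet, Fin.sum_univ_two,
    curvatureCoeff, curvatureCoeff, Fin.sum_univ_two, Fin.sum_univ_two, Matrix.det_fin_two]
  have h000 := hc 0 0 0
  have h001 := hc 0 0 1
  have h011 := hc 0 1 1
  have h010 := hc 0 1 0
  rw [hs3] at e1
  rw [hs2] at e2 h010
  rw [mink_comm (pd 0 X u) (pd 0 (pd 0 X) u), mink_comm (pd 0 X u) (pd 0 (pd 1 X) u)] at e1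
  rw [mink_comm (pd 0 X u) (pd 0 (pd 1 X) u), mink_comm (pd 0 X u) (pd 1 (pd 1 X) u)] at e2
  rw [mink_comm (pd 0 X u), mink_comm (pd 1 X u)] at g1 g2
  rw [hgs]
  linear_combination e1 - e2 + christoffel (patchMetric X) 0 1 1 u * h000
    - christoffel (patchMetric X) 0 0 1 u * h010 + christoffel (patchMetric X) 1 1 1 u * h001
    - christoffel (patchMetric X) 1 0 1 u * h011 + g1 - g2

end Patch

end DeSitter

namespace DeSitter

open Filter Topology

variable {M : Type*} [TopologicalSpace M] [ChartedSpace (EuclideanSpace ℝ (Fin 2)) M]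
  {X N : M → L4}

/-! ### Surfaces in charts -/

section Chart

variable [IsManifold (𝓡 2) ∞ M]

/-- In a chart around `q`, derivatives are differentials composed with a fixed linear
equivalence onto the tangent space. -/
theorem exists_chart_frame (p : M) {q : M}
    (hq : q ∈ (chartAt (EuclideanSpace ℝ (Fin 2)) p).source) :
    ∃ B : EuclideanSpace ℝ (Fin 2) ≃L[ℝ] TangentSpace (𝓡 2) q,
      ∀ Y : M → L4, ContMDiff (𝓡 2) 𝓘(ℝ, L4) ∞ Y → ∀ e,
        fderiv ℝ (Y ∘ (chartAt (EuclideanSpace ℝ (Fin 2)) p).symm)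
          (chartAt (EuclideanSpace ℝ (Fin 2)) p q) e = differential Y q (B e) := by
  have : IsManifold (𝓡 2) 1 M := IsManifold.of_le (n := ∞) (by simp)
  set φ := chartAt (EuclideanSpace ℝ (Fin 2)) p with hφ
  have hd := (mdifferentiable_chart (I := 𝓡 2) p).symm
  have hq' : φ q ∈ φ.symm.source := φ.map_source hq
  have hqq : φ.symm (φ q) = q := φ.left_inv hq
  let B := hd.mfderiv hq'
  have hB : ∀ Y : M → L4, ContMDiff (𝓡 2) 𝓘(ℝ, L4) ∞ Y → ∀ e,
      fderiv ℝ (Y ∘ φ.symm) (φ q) e = differential Y (φ.symm (φ q)) (B e) := by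
    intro Y hY e
    have hc := mfderiv_comp (I := 𝓡 2) (I' := 𝓡 2) (I'' := 𝓘(ℝ, L4)) (φ q)
      (g := Y) (f := φ.symm) (hY.mdifferentiableAt (by simp)) (hd.mdifferentiableAt hq')
    rw [mfderiv_eq_fderiv] at hc
    exact congrArg (fun L => L e) hc
  -- The type of `B` depends on the base point; packing it in an existential allows rewriting
  -- `φ.symm (φ q)` to `q`.
  have hex : ∃ B : EuclideanSpace ℝ (Fin 2) ≃L[ℝ] TangentSpace (𝓡 2) (φ.symm (φ q)),
      ∀ Y : M → L4, ContMDiff (𝓡 2) 𝓘(ℝ, L4) ∞ Y → ∀ e,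
        fderiv ℝ (Y ∘ φ.symm) (φ q) e = differential Y (φ.symm (φ q)) (B e) := ⟨B, hB⟩
  rwa [hqq] at hex

theorem contDiffAt_comp_chart_symm {Y : M → L4} (hY : ContMDiff (𝓡 2) 𝓘(ℝ, L4) ∞ Y) (p : M)
    {u : EuclideanSpace ℝ (Fin 2)}
    (hu : u ∈ (chartAt (EuclideanSpace ℝ (Fin 2)) p).target) :
    ContDiffAt ℝ ∞ (Y ∘ (chartAt (EuclideanSpace ℝ (Fin 2)) p).symm) u := by
  have h := hY.comp_contMDiffOn (contMDiffOn_chart_symm (I := 𝓡 2) (n := ∞) (x := p))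
  exact (contMDiffOn_iff_contDiffOn.mp h).contDiffAt
    ((chartAt (EuclideanSpace ℝ (Fin 2)) p).open_target.mem_nhds hu)

theorem eventually_mink_pd_eq_zero (hX : ContMDiff (𝓡 2) 𝓘(ℝ, L4) ∞ X) (hN : IsUnitNormal X N)
    (p : M) : ∀ᶠ u in 𝓝 (chartAt (EuclideanSpace ℝ (Fin 2)) p p), ∀ i,
      mink ((N ∘ (chartAt (EuclideanSpace ℝ (Fin 2)) p).symm) u)
        (pd i (X ∘ (chartAt (EuclideanSpace ℝ (Fin 2)) p).symm) u) = 0 := by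
  set φ := chartAt (EuclideanSpace ℝ (Fin 2)) p with hφ
  filter_upwards [φ.open_target.mem_nhds (φ.map_source (mem_chart_source _ p))] with u hu i
  obtain ⟨B, hB⟩ := exists_chart_frame p (φ.map_target hu)
  have h := hB X hX (EuclideanSpace.single i 1)
  rw [← hφ, φ.right_inv hu] at h
  rw [pd, h]
  exact hN.normal _ _

/-- The second fundamental form in a chart. -/
theorem secondForm_chart (hX : ContMDiff (𝓡 2) 𝓘(ℝ, L4) ∞ X) (hN : IsUnitNormal X N) (p : M)
    (i j : Fin 2) :
    -mink (pd j (X ∘ (chartAt (EuclideanSpace ℝ (Fin 2)) p).symm)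
        (chartAt (EuclideanSpace ℝ (Fin 2)) p p))
      (pd i (N ∘ (chartAt (EuclideanSpace ℝ (Fin 2)) p).symm)
        (chartAt (EuclideanSpace ℝ (Fin 2)) p p)) =
    mink (pd i (pd j (X ∘ (chartAt (EuclideanSpace ℝ (Fin 2)) p).symm))
        (chartAt (EuclideanSpace ℝ (Fin 2)) p p)) (N p) := by
  set φ := chartAt (EuclideanSpace ℝ (Fin 2)) p with hφ
  have hu : φ p ∈ φ.target := φ.map_source (mem_chart_source _ p)
  have h := mink_pd_pd_add
    ((contDiffAt_comp_chart_symm hN.smooth p hu).differentiableAt (by simp))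
    (contDiffAt_comp_chart_symm hX p hu) (eventually_mink_pd_eq_zero hX hN p) i j
  rw [← hφ, Function.comp_apply, φ.left_inv (mem_chart_source _ p), mink_comm (N p)] at h
  rw [mink_comm]
  linarith

/-- In a chart II has the coefficients ⟨∂ᵢ∂ⱼX, N⟩, and mixed partial derivatives commute. -/
theorem secondForm_symm (hX : ContMDiff (𝓡 2) 𝓘(ℝ, L4) ∞ X) (hN : IsUnitNormal X N) (p : M)
    (v w : TangentSpace (𝓡 2) p) : secondForm X N p v w = secondForm X N p w v := by
  obtain ⟨B, hB⟩ := exists_chart_frame p (mem_chart_source (EuclideanSpace ℝ (Fin 2)) p)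
  have hs := secondForm_chart hX hN p
  have hu := (chartAt (EuclideanSpace ℝ (Fin 2)) p).map_source (mem_chart_source _ p)
  have hc := pd_comm (eventually_contDiffAt_two
    (contDiffAt_comp_chart_symm hX p hu)).self_of_nhds 0 1
  have h01 := (hs 0 1).trans ((congrArg (fun y => mink y (N p)) hc).trans (hs 1 0).symm)
  obtain ⟨v, rfl⟩ := B.surjective v
  obtain ⟨w, rfl⟩ := B.surjective w
  simp only [secondForm, ← hB X hX, ← hB N hN.smooth]
  simp only [pd] at h01
  rw [← ContinuousLinearMap.coe_coe (fderiv ℝ (X ∘ _) _),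
    ← ContinuousLinearMap.coe_coe (fderiv ℝ (N ∘ _) _)] at h01 ⊢
  rw [mink_map_map _ _ v w, mink_map_map _ _ w v]
  linear_combination (v 1 * w 0 - v 0 * w 1) * h01

theorem mink_differential_add {Y Z : M → L4} (hY : ContMDiff (𝓡 2) 𝓘(ℝ, L4) ∞ Y)
    (hZ : ContMDiff (𝓡 2) 𝓘(ℝ, L4) ∞ Z) {c : ℝ} (h : ∀ p, mink (Y p) (Z p) = c) (p : M)
    (v : TangentSpace (𝓡 2) p) :
    mink (differential Y p v) (Z p) + mink (Y p) (differential Z p v) = 0 := by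
  obtain ⟨B, hB⟩ := exists_chart_frame p (mem_chart_source (EuclideanSpace ℝ (Fin 2)) p)
  obtain ⟨v, rfl⟩ := B.surjective v
  rw [← hB Y hY, ← hB Z hZ]
  have hu := (chartAt (EuclideanSpace ℝ (Fin 2)) p).map_source (mem_chart_source _ p)
  have hp := (chartAt (EuclideanSpace ℝ (Fin 2)) p).left_inv (mem_chart_source _ p)
  have key : ∀ i, _ := fun i => pd_mink
    ((contDiffAt_comp_chart_symm hY p hu).differentiableAt (by simp))
    ((contDiffAt_comp_chart_symm hZ p hu).differentiableAt (by simp)) i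
  simp only [Function.comp_apply, h, pd_const, hp] at key
  have hYv := map_euclidean_two (fderiv ℝ (Y ∘ (chartAt (EuclideanSpace ℝ (Fin 2)) p).symm)
    (chartAt (EuclideanSpace ℝ (Fin 2)) p p) : EuclideanSpace ℝ (Fin 2) →ₗ[ℝ] L4) v
  have hZv := map_euclidean_two (fderiv ℝ (Z ∘ (chartAt (EuclideanSpace ℝ (Fin 2)) p).symm)
    (chartAt (EuclideanSpace ℝ (Fin 2)) p p) : EuclideanSpace ℝ (Fin 2) →ₗ[ℝ] L4) v
  simp only [ContinuousLinearMap.coe_coe] at hYv hZv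
  have k0 := key 0
  have k1 := key 1
  simp only [pd] at k0 k1
  rw [hYv, hZv]
  simp only [mink_add_left, mink_add_right, mink_smul_left, mink_smul_right]
  linear_combination -v 0 * k0 - v 1 * k1

/-! ### The normal field as a surface -/

theorem mink_self_differential {Y : M → L4} (hY : ContMDiff (𝓡 2) 𝓘(ℝ, L4) ∞ Y) {c : ℝ}
    (h : ∀ p, mink (Y p) (Y p) = c) (p : M) (v : TangentSpace (𝓡 2) p) :
    mink (Y p) (differential Y p v) = 0 := by
  have := mink_differential_add hY hY h p v
  rw [mink_comm (differential Y p v)] at this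
  linarith

/-- A surface is a unit normal field of its unit normal field. -/
theorem IsTimelikeSurface.isUnitNormal_swap (hX : IsTimelikeSurface X) (hN : IsUnitNormal X N) :
    IsUnitNormal N X where
  smooth := hX.smooth
  unit := hX.mem_deSitter
  tangent_deSitter p := by rw [mink_comm, hN.tangent_deSitter]
  normal p v := by
    have h := mink_differential_add hN.smooth hX.smooth hN.tangent_deSitter p v
    rwa [hN.normal, add_zero, mink_comm] at h

/-- Where the Gauss curvature differs from `1`, the second fundamental form is nonsingular; hence
the normal field is an immersion with the same tangent planes. -/
theorem differential_normal_range (hX : IsTimelikeSurface X) (hN : IsUnitNormal X N) (p : M)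
    (hK : gaussCurvature X p ≠ 1) :
    Function.Injective (differential N p) ∧
      LinearMap.range (differential N p : TangentSpace (𝓡 2) p →ₗ[ℝ] L4) =
        LinearMap.range (differential X p : TangentSpace (𝓡 2) p →ₗ[ℝ] L4) := by
  obtain ⟨B, hB⟩ := exists_chart_frame p (mem_chart_source (EuclideanSpace ℝ (Fin 2)) p)
  have hs := secondForm_chart hX.smooth hN p
  have hp := (chartAt (EuclideanSpace ℝ (Fin 2)) p).left_inv (mem_chart_source _ p)
  have hu := (chartAt (EuclideanSpace ℝ (Fin 2)) p).map_source (mem_chart_source _ p)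
  set X' := X ∘ (chartAt (EuclideanSpace ℝ (Fin 2)) p).symm with hX'
  set N' := N ∘ (chartAt (EuclideanSpace ℝ (Fin 2)) p).symm with hN'
  set u := chartAt (EuclideanSpace ℝ (Fin 2)) p p with hu'
  let a : EuclideanSpace ℝ (Fin 2) →ₗ[ℝ] L4 := (fderiv ℝ X' u : _ →ₗ[ℝ] _)
  let b : EuclideanSpace ℝ (Fin 2) →ₗ[ℝ] L4 := (fderiv ℝ N' u : _ →ₗ[ℝ] _)
  have ha : ∀ e, a e = differential X p (B e) := hB X hX.smooth
  have hb : ∀ e, b e = differential N p (B e) := hB N hN.smooth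
  have hNX := hX.isUnitNormal_swap hN
  have hneg : ∃ v, mink (a v) (a v) < 0 := by
    obtain ⟨v, hv⟩ := hX.exists_timelike p
    exact ⟨B.symm v, by rw [ha, B.apply_symm_apply]; exact hv⟩
  have hpos : ∃ v, 0 < mink (a v) (a v) := by
    obtain ⟨v, hv⟩ := hX.exists_spacelike p
    exact ⟨B.symm v, by rw [ha, B.apply_symm_apply]; exact hv⟩
  have hg := gram_neg_of_indefinite hneg hpos
  have hgdet : (patchMetric X' u).det ≠ 0 := by
    rw [Matrix.det_fin_two]
    refine ne_of_lt (lt_of_eq_of_lt ?_ hg)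
    simp only [patchMetric, Matrix.of_apply, pd, a, ContinuousLinearMap.coe_coe]
    rw [mink_comm (fderiv ℝ X' u (EuclideanSpace.single 1 1))
      (fderiv ℝ X' u (EuclideanSpace.single 0 1)), sq]
  have hNu : N' u = N p := congrArg N hp
  have hG := metricCurvature_patchMetric (N := N') (contDiffAt_comp_chart_symm hX.smooth p hu)
    (Eventually.of_forall fun x => hX.mem_deSitter _) (hN.unit _) (hN.tangent_deSitter _)
    (eventually_mink_pd_eq_zero hX.smooth hN p).self_of_nhds hgdet
  -- This is det II, the two signs cancelling; its vanishing would give K = 1 by the Gauss equation.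
  have hdet : mink (a (EuclideanSpace.single 0 1)) (b (EuclideanSpace.single 0 1)) *
      mink (a (EuclideanSpace.single 1 1)) (b (EuclideanSpace.single 1 1)) -
      mink (a (EuclideanSpace.single 0 1)) (b (EuclideanSpace.single 1 1)) *
      mink (a (EuclideanSpace.single 1 1)) (b (EuclideanSpace.single 0 1)) ≠ 0 := by
    intro h0
    refine hK (hG.trans ?_)
    have hc := pd_comm (eventually_contDiffAt_two
      (contDiffAt_comp_chart_symm hX.smooth p hu)).self_of_nhds 0 1
    have h00 : -mink (a (EuclideanSpace.single 0 1)) (b (EuclideanSpace.single 0 1)) = _ := hs 0 0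
    have h11 : -mink (a (EuclideanSpace.single 1 1)) (b (EuclideanSpace.single 1 1)) = _ := hs 1 1
    have h01 : -mink (a (EuclideanSpace.single 1 1)) (b (EuclideanSpace.single 0 1)) = _ := hs 0 1
    have h10 : -mink (a (EuclideanSpace.single 0 1)) (b (EuclideanSpace.single 1 1)) = _ :=
      (hs 1 0).trans (congrArg (fun y => mink y (N p)) hc).symm
    rw [hNu, sq, ← h00, ← h11]
    nth_rw 1 [← h01]
    rw [← h10]
    rw [show ∀ s t q r : ℝ, -s * -t - -q * -r = s * t - r * q by intros; ring, h0]
    simp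
  have hmain := injective_and_range_eq (a := a) (b := b) (hX.mem_deSitter p) (hN.unit p)
    (hN.tangent_deSitter p) (fun v => by rw [ha]; exact hN.normal p _)
    (fun v => by rw [ha]; exact mink_self_differential hX.smooth hX.mem_deSitter p _)
    (fun v => by rw [hb]; exact mink_self_differential hN.smooth hN.unit p _)
    (fun v => by rw [hb]; exact hNX.normal p _)
    (fun v w h => B.injective (hX.immersion p (by rwa [ha, ha] at h))) hneg hpos hdet
  have hrange : ∀ (c : EuclideanSpace ℝ (Fin 2) →ₗ[ℝ] L4) (Y : M → L4),
      (∀ e, c e = differential Y p (B e)) →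
      LinearMap.range (differential Y p : TangentSpace (𝓡 2) p →ₗ[ℝ] L4) =
        LinearMap.range c := by
    intro c Y hc
    refine le_antisymm ?_ ?_
    · rintro _ ⟨v, rfl⟩
      exact ⟨B.symm v, by rw [hc, B.apply_symm_apply]; rfl⟩
    · rintro _ ⟨v, rfl⟩
      exact ⟨B v, (hc v).symm⟩
  refine ⟨fun v w h => ?_, ?_⟩
  · refine B.symm.injective (hmain.1 ?_)
    rwa [hb, hb, B.apply_symm_apply, B.apply_symm_apply]
  · rw [hrange a X ha, hrange b N hb, hmain.2]

/-- The tangent planes of `X` and `N` coincide, so a time-like or space-like vector tangent to `X`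
is also tangent to `N`. -/
theorem isTimelikeSurface_normal (hX : IsTimelikeSurface X) (hN : IsUnitNormal X N)
    (hK : ∀ p, gaussCurvature X p ≠ 1) : IsTimelikeSurface N where
  smooth := hN.smooth
  mem_deSitter := hN.unit
  immersion p := (differential_normal_range hX hN p (hK p)).1
  exists_timelike p := by
    obtain ⟨v, hv⟩ := hX.exists_timelike p
    have hr := (differential_normal_range hX hN p (hK p)).2
    obtain ⟨w, hw⟩ : differential X p v ∈ LinearMap.range
      (differential N p : TangentSpace (𝓡 2) p →ₗ[ℝ] L4) := hr ▸ ⟨v, rfl⟩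
    have hw' : differential N p w = differential X p v := hw
    exact ⟨w, by rwa [firstForm, hw']⟩
  exists_spacelike p := by
    obtain ⟨v, hv⟩ := hX.exists_spacelike p
    have hr := (differential_normal_range hX hN p (hK p)).2
    obtain ⟨w, hw⟩ : differential X p v ∈ LinearMap.range
      (differential N p : TangentSpace (𝓡 2) p →ₗ[ℝ] L4) := hr ▸ ⟨v, rfl⟩
    have hw' : differential N p w = differential X p v := hw
    exact ⟨w, by rwa [firstForm, hw']⟩

theorem isUmbilic_of_isUmbilic_normal (hX : IsTimelikeSurface X) (hN : IsUnitNormal X N) (p : M)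
    (hK : gaussCurvature X p ≠ 1) (h : IsUmbilic N X p) : IsUmbilic X N p := by
  obtain ⟨c, hc⟩ := h
  exact proportional_of_range_eq
    (a := (differential X p : TangentSpace (𝓡 2) p →ₗ[ℝ] L4))
    (b := (differential N p : TangentSpace (𝓡 2) p →ₗ[ℝ] L4))
    (differential_normal_range hX hN p hK).2 (hX.exists_timelike p) hc

end Chart

end DeSitter

namespace DeSitter

open Filter Topology

/-! ### The normal Gauss map -/

/-- The normal Gauss map as a function of a point and a normal vector. -/
noncomputable def gaussVector (z : L4 × L4) : Fin 3 → ℝ :=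
  ![z.2 1 - (z.2 0 - z.2 3) / (z.1 0 - z.1 3) * z.1 1,
    z.2 2 - (z.2 0 - z.2 3) / (z.1 0 - z.1 3) * z.1 2,
    -((z.2 0 - z.2 3) / (z.1 0 - z.1 3))]

/-- Left translation is a homothety followed by a Euclidean translation. -/
theorem fderiv_groupMul (a y z : Fin 3 → ℝ) : fderiv ℝ (groupMul a) y z = a 2 • z := by
  have h : groupMul a = fun y => a 2 • y + ![a 0, a 1, 0] := by
    funext y i
    fin_cases i <;> simp [groupMul]
  rw [h, fderiv_add_const, fderiv_fun_const_smul differentiableAt_fun_id]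
  simp

theorem hasFDerivAt_proj (i : Fin 4) (x : L4) :
    HasFDerivAt (fun y : L4 => y i) (ContinuousLinearMap.proj (R := ℝ) (φ := fun _ => ℝ) i) x :=
  (ContinuousLinearMap.proj (R := ℝ) (φ := fun _ : Fin 4 => ℝ) i).hasFDerivAt

theorem hasFDerivAt_fin_three {E : Type*} [NormedAddCommGroup E] [NormedSpace ℝ E]
    {f : E → Fin 3 → ℝ} {x : E} {f₀ f₁ f₂ : E →L[ℝ] ℝ}
    (h₀ : HasFDerivAt (fun y => f y 0) f₀ x) (h₁ : HasFDerivAt (fun y => f y 1) f₁ x)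
    (h₂ : HasFDerivAt (fun y => f y 2) f₂ x) :
    HasFDerivAt f (ContinuousLinearMap.pi ![f₀, f₁, f₂]) x := by
  refine hasFDerivAt_pi.mpr fun i => ?_
  fin_cases i
  · exact h₀
  · exact h₁
  · exact h₂

theorem fderiv_halfSpace {x : L4} (hx : x 0 ≠ x 3) (n : L4) :
    fderiv ℝ halfSpace x n = |x 0 - x 3|⁻¹ • gaussVector (x, n) := by
  have hw : x 0 - x 3 ≠ 0 := sub_ne_zero.mpr hx
  have habs : HasDerivAt (fun s : ℝ => |s|⁻¹) _ (x 0 - x 3) :=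
    (hasDerivAt_abs hw).inv (abs_ne_zero.mpr hw)
  have hsub : HasFDerivAt (fun y : L4 => y 0 - y 3) _ x :=
    (hasFDerivAt_proj 0 x).sub (hasFDerivAt_proj 3 x)
  have hr : HasFDerivAt (fun y : L4 => |y 0 - y 3|⁻¹) _ x :=
    HasDerivAt.comp_hasFDerivAt (h₂ := fun s : ℝ => |s|⁻¹) x habs hsub
  have h₂ : (fun y : L4 => |y 0 - y 3|⁻¹) = fun y => halfSpace y 2 :=
    funext fun y => (one_div _).symm
  have h := hasFDerivAt_fin_three (f := halfSpace) ((hasFDerivAt_proj 1 x).mul hr)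
    ((hasFDerivAt_proj 2 x).mul hr) (h₂ ▸ hr)
  -- The sign from differentiating the absolute value is absorbed here, so both components of x₀ ≠
  -- x₃ share one formula.
  have hs : (SignType.sign (x 0 - x 3) : ℝ) / |x 0 - x 3| = (x 0 - x 3)⁻¹ := by
    rcases lt_or_gt_of_ne hw with h | h
    · rw [sign_neg h, abs_of_neg h, SignType.coe_neg_one, neg_div_neg_eq, one_div]
    · rw [sign_pos h, abs_of_pos h]; simp
  have hs' : (SignType.sign (x 0 - x 3) : ℝ) / |x 0 - x 3| ^ 2 =
      |x 0 - x 3|⁻¹ * (x 0 - x 3)⁻¹ := by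
    rw [← hs]; ring
  rw [h.fderiv, neg_div, hs']
  ext i
  fin_cases i
  all_goals
    simp [gaussVector]
    ring

theorem normalGaussMap_eq {M : Type*} {X N : M → L4} {p : M} (hp : p ∈ gaussDomain X) :
    normalGaussMap X N p = gaussVector (X p, N p) := by
  have hw : |X p 0 - X p 3| ≠ 0 := abs_ne_zero.mpr (sub_ne_zero.mpr hp)
  rw [normalGaussMap, fderiv_groupMul, fderiv_halfSpace hp, smul_smul]
  have : groupInv (halfSpace (X p)) 2 = |X p 0 - X p 3| := by simp [groupInv, halfSpace]
  rw [this, mul_inv_cancel₀ hw, one_smul]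

/-- The long quotient occurring in all three components is the derivative of f = (n₀ - n₃) / (x₀ -
x₃). -/
theorem fderiv_gaussVector {x n : L4} (hx : x 0 ≠ x 3) :
    ∃ L : L4 × L4 →L[ℝ] (Fin 3 → ℝ), HasFDerivAt gaussVector L (x, n) ∧
      ∀ a b : L4, L (a, b) =
        ![b 1 - (n 0 - n 3) / (x 0 - x 3) * a 1 -
            ((b 0 - b 3) * (x 0 - x 3) - (n 0 - n 3) * (a 0 - a 3)) / (x 0 - x 3) ^ 2 * x 1,
          b 2 - (n 0 - n 3) / (x 0 - x 3) * a 2 -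
            ((b 0 - b 3) * (x 0 - x 3) - (n 0 - n 3) * (a 0 - a 3)) / (x 0 - x 3) ^ 2 * x 2,
          -(((b 0 - b 3) * (x 0 - x 3) - (n 0 - n 3) * (a 0 - a 3)) / (x 0 - x 3) ^ 2)] := by
  have hw : x 0 - x 3 ≠ 0 := sub_ne_zero.mpr hx
  have h1 : ∀ i, HasFDerivAt (fun z : L4 × L4 => z.1 i) _ (x, n) := fun i =>
    ((ContinuousLinearMap.proj (R := ℝ) (φ := fun _ : Fin 4 => ℝ) i).comp
      (ContinuousLinearMap.fst ℝ L4 L4)).hasFDerivAt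
  have h2 : ∀ i, HasFDerivAt (fun z : L4 × L4 => z.2 i) _ (x, n) := fun i =>
    ((ContinuousLinearMap.proj (R := ℝ) (φ := fun _ : Fin 4 => ℝ) i).comp
      (ContinuousLinearMap.snd ℝ L4 L4)).hasFDerivAt
  have hsub : HasFDerivAt (fun z : L4 × L4 => z.1 0 - z.1 3) _ (x, n) := (h1 0).sub (h1 3)
  have hinv : HasFDerivAt (fun z : L4 × L4 => (z.1 0 - z.1 3)⁻¹) _ (x, n) :=
    (hasDerivAt_inv hw).comp_hasFDerivAt (x, n) hsub
  have hf : HasFDerivAt (fun z : L4 × L4 => (z.2 0 - z.2 3) / (z.1 0 - z.1 3)) _ (x, n) :=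
    ((h2 0).sub (h2 3)).mul hinv
  refine ⟨_, hasFDerivAt_fin_three ((h2 1).sub (hf.mul (h1 1))) ((h2 2).sub (hf.mul (h1 2)))
    hf.neg, fun a b => ?_⟩
  ext i
  fin_cases i
  all_goals
    simp
    field_simp
    ring

theorem isOpen_gaussDomain {M : Type*} [TopologicalSpace M] {X : M → L4} (hX : Continuous X) :
    IsOpen (gaussDomain X) :=
  isOpen_ne_fun ((continuous_apply 0).comp hX) ((continuous_apply 3).comp hX)

variable {M : Type*} [TopologicalSpace M] [ChartedSpace (EuclideanSpace ℝ (Fin 2)) M]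
  {X N : M → L4}

/-- `IV = III + 2 f II + f² I` with `f = (N₀ - N₃) / (X₀ - X₃)`. -/
theorem fourthForm_eq [IsManifold (𝓡 2) ∞ M] (hX : IsTimelikeSurface X) (hN : IsUnitNormal X N)
    {p : M} (hp : p ∈ gaussDomain X) (v w : TangentSpace (𝓡 2) p) :
    fourthForm X N p v w = firstForm N p v w +
      2 * ((N p 0 - N p 3) / (X p 0 - X p 3)) * secondForm X N p v w +
      ((N p 0 - N p 3) / (X p 0 - X p 3)) ^ 2 * firstForm X p v w := by
  obtain ⟨L, hL, hLv⟩ := fderiv_gaussVector (n := N p) hp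
  have hXd : HasMFDerivAt (𝓡 2) 𝓘(ℝ, L4) X p (differential X p) :=
    (hX.smooth.mdifferentiableAt (by simp)).hasMFDerivAt
  have hNd : HasMFDerivAt (𝓡 2) 𝓘(ℝ, L4) N p (differential N p) :=
    (hN.smooth.mdifferentiableAt (by simp)).hasMFDerivAt
  have hev : normalGaussMap X N =ᶠ[𝓝 p] fun q => gaussVector (X q, N q) :=
    Filter.eventually_of_mem ((isOpen_gaussDomain hX.smooth.continuous).mem_nhds hp)
      fun q hq => normalGaussMap_eq hq
  have hd : ∀ v, normalGaussDifferential X N p v =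
      L (differential X p v, differential N p v) := by
    intro v
    have h := (HasMFDerivAt.comp p (hL.hasMFDerivAt) (hXd.prodMk hNd)).congr_of_eventuallyEq hev
    rw [normalGaussDifferential, h.mfderiv]
    rfl
  have hNX := hX.isUnitNormal_swap hN
  have hs := secondForm_symm hX.smooth hN p v w
  have hXX := hX.mem_deSitter p
  have e1 := hN.normal p v
  have e2 := hN.normal p w
  have e3 := hNX.normal p v
  have e4 := hNX.normal p w
  have e5 := mink_self_differential hX.smooth hX.mem_deSitter p v
  have e6 := mink_self_differential hX.smooth hX.mem_deSitter p w
  have hw : X p 0 - X p 3 ≠ 0 := sub_ne_zero.mpr hp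
  rw [fourthForm, hd, hd, hLv, hLv]
  simp only [secondForm, firstForm] at *
  generalize differential X p v = a at *
  generalize differential X p w = a' at *
  generalize differential N p v = b at *
  generalize differential N p w = b' at *
  generalize N p = n at *
  generalize X p = x at *
  set f := (n 0 - n 3) / (x 0 - x 3) with hf
  -- Here g = df, and c = b - f a - g x is the derivative of N - fX. Its 0th and 3rd coordinates
  -- agree, so ⟨c, c'⟩ only sees coordinates 1 and 2, and IV = ⟨c, c'⟩ - g g'. Expanding ⟨c, c'⟩ by
  -- orthogonality, the g g' terms cancel because ⟨x, x⟩ = 1.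
  have hδ : ∀ a b : L4, ∃ g, ((b 0 - b 3) * (x 0 - x 3) - (n 0 - n 3) * (a 0 - a 3)) /
      (x 0 - x 3) ^ 2 = g ∧ b 0 - b 3 - f * (a 0 - a 3) - g * (x 0 - x 3) = 0 := by
    intro a b
    refine ⟨_, rfl, ?_⟩
    rw [hf]
    field_simp
    ring
  obtain ⟨g, hg, h1⟩ := hδ a b
  obtain ⟨g', hg', h2⟩ := hδ a' b'
  rw [hg, hg']
  clear_value f
  simp only [mink3, Matrix.cons_val_zero, Matrix.cons_val_one, Matrix.cons_val]
  simp only [mink] at *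
  linear_combination -f * hs - g' * e3 - g * e4 + f * g' * e5 + f * g * e6 + g * g' * hXX
    + (b' 0 - f * a' 0 - g' * x 0) * h1 + (b 3 - f * a 3 - g * x 3) * h2

end DeSitter

namespace DeSitter

open Filter Topology

/-! ### Conformality of the normal Gauss map -/

theorem contDiffAt_fderiv_apply {f : EuclideanSpace ℝ (Fin 2) → L4}
    {u : EuclideanSpace ℝ (Fin 2)} (hf : ContDiffAt ℝ ∞ f u) (e : EuclideanSpace ℝ (Fin 2)) :
    ContDiffAt ℝ ∞ (fun x => fderiv ℝ f x e) u :=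
  (hf.fderiv_right (m := ∞) (by simp)).clm_apply contDiffAt_const

section Conformal

variable {M : Type*} [TopologicalSpace M] [ChartedSpace (EuclideanSpace ℝ (Fin 2)) M]
  {X N : M → L4}

theorem mink_self_nonneg {v : L4} (h : v 0 = v 3) : 0 ≤ mink v v := by
  rw [mink, h]
  nlinarith [sq_nonneg (v 1), sq_nonneg (v 2)]

theorem contMDiff_apply_sub {Y : M → L4} (hY : ContMDiff (𝓡 2) 𝓘(ℝ, L4) ∞ Y) :
    ContMDiff (𝓡 2) 𝓘(ℝ, ℝ) ∞ fun p => Y p 0 - Y p 3 :=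
  (((ContinuousLinearMap.proj (R := ℝ) (φ := fun _ : Fin 4 => ℝ) 0) -
    (ContinuousLinearMap.proj (R := ℝ) (φ := fun _ : Fin 4 => ℝ) 3)).contMDiff).comp hY

variable [IsManifold (𝓡 2) ∞ M]

theorem secondForm_swap (hX : IsTimelikeSurface X) (hN : IsUnitNormal X N) (p : M)
    (v w : TangentSpace (𝓡 2) p) : secondForm N X p v w = secondForm X N p v w := by
  rw [secondForm_symm hX.smooth hN, secondForm, secondForm, mink_comm]

/-- In a chart, the domain of the normal Gauss map accumulates at every point: a time-like surface
is nowhere tangent to a null hyperplane through the origin. -/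
theorem frequently_gaussDomain (hX : IsTimelikeSurface X) (p : M) :
    ∃ᶠ u in 𝓝 (chartAt (EuclideanSpace ℝ (Fin 2)) p p),
      (chartAt (EuclideanSpace ℝ (Fin 2)) p).symm u ∈ gaussDomain X := by
  obtain ⟨B, hB⟩ := exists_chart_frame p (mem_chart_source (EuclideanSpace ℝ (Fin 2)) p)
  have hu := (chartAt (EuclideanSpace ℝ (Fin 2)) p).map_source (mem_chart_source _ p)
  set φ := chartAt (EuclideanSpace ℝ (Fin 2)) p
  rw [Filter.Frequently]
  intro h
  have hev : (fun u => (X ∘ φ.symm) u 0 - (X ∘ φ.symm) u 3) =ᶠ[𝓝 (φ p)] fun _ => (0 : ℝ) :=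
    h.mono fun u hu => sub_eq_zero.mpr (not_not.mp hu)
  have hd := hasFDerivAt_pi'.mp ((contDiffAt_comp_chart_symm hX.smooth p hu).differentiableAt
    (by simp)).hasFDerivAt
  -- If X₀ - X₃ vanished near the point, every tangent vector would satisfy v₀ = v₃ and none could
  -- be time-like.
  have h0 := (((hd 0).sub (hd 3)).congr_of_eventuallyEq hev.symm).unique
    (hasFDerivAt_const (0 : ℝ) (φ p))
  obtain ⟨v, hv⟩ := hX.exists_timelike p
  have h1 := congrArg (fun L => L (B.symm v)) h0
  simp only [_root_.sub_apply, ContinuousLinearMap.comp_apply,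
    ContinuousLinearMap.proj_apply, _root_.zero_apply] at h1
  have h2 := hB X hX.smooth (B.symm v)
  rw [B.apply_symm_apply] at h2
  rw [h2, sub_eq_zero] at h1
  exact absurd hv (not_lt.mpr (mink_self_nonneg h1))

/-- If the normal Gauss map of a surface without umbilics is conformal, its domain contains that
of the normal Gauss map of the normal field. -/
theorem gaussDomain_normal_subset (hX : IsTimelikeSurface X) (hN : IsUnitNormal X N)
    (humb : ∀ p, ¬ IsUmbilic X N p) (hc : HasConformalNormalGaussMap X N) :
    gaussDomain N ⊆ gaussDomain X := by
  obtain ⟨ρ, -, hρ⟩ := hc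
  intro p hp
  by_contra hpX
  have hpX' : X p 0 = X p 3 := not_not.mp hpX
  obtain ⟨B, hB⟩ := exists_chart_frame p (mem_chart_source (EuclideanSpace ℝ (Fin 2)) p)
  have hu := (chartAt (EuclideanSpace ℝ (Fin 2)) p).map_source (mem_chart_source _ p)
  have hpp := (chartAt (EuclideanSpace ℝ (Fin 2)) p).left_inv (mem_chart_source _ p)
  have hfreq := frequently_gaussDomain hX p
  set φ := chartAt (EuclideanSpace ℝ (Fin 2)) p with hφ
  have hXs := contDiffAt_comp_chart_symm hX.smooth p hu
  have hNs := contDiffAt_comp_chart_symm hN.smooth p hu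
  let I := fun u v w => mink (fderiv ℝ (X ∘ φ.symm) u v) (fderiv ℝ (X ∘ φ.symm) u w)
  let II := fun u v w => -mink (fderiv ℝ (X ∘ φ.symm) u v) (fderiv ℝ (N ∘ φ.symm) u w)
  let III := fun u v w => mink (fderiv ℝ (N ∘ φ.symm) u v) (fderiv ℝ (N ∘ φ.symm) u w)
  -- (X₀ - X₃)² IV without its II-term: it extends continuously over X₀ = X₃, where it reduces to
  -- (N₀ - N₃)² I.
  let T := fun u v w => ((X ∘ φ.symm) u 0 - (X ∘ φ.symm) u 3) ^ 2 * III u v w +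
    ((N ∘ φ.symm) u 0 - (N ∘ φ.symm) u 3) ^ 2 * I u v w
  have hII : ∀ v w, ContinuousAt (fun u => II u v w) (φ p) := fun v w =>
    (contDiffAt_mink (contDiffAt_fderiv_apply hXs v)
      (contDiffAt_fderiv_apply hNs w)).continuousAt.neg
  have hT : ∀ v w, ContinuousAt (fun u => T u v w) (φ p) := by
    intro v w
    have hXc := continuousAt_pi.mp hXs.continuousAt
    have hNc := continuousAt_pi.mp hNs.continuousAt
    exact ((((hXc 0).sub (hXc 3)).pow 2).mul (contDiffAt_mink (contDiffAt_fderiv_apply hNs v)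
        (contDiffAt_fderiv_apply hNs w)).continuousAt).add
      ((((hNc 0).sub (hNc 3)).pow 2).mul (contDiffAt_mink (contDiffAt_fderiv_apply hXs v)
        (contDiffAt_fderiv_apply hXs w)).continuousAt)
  have hprop : ∀ u ∈ φ.target, φ.symm u ∈ gaussDomain X → ∃ c, ∀ v w, T u v w = c * II u v w := by
    intro u hu' hUX
    obtain ⟨B', hB'⟩ := exists_chart_frame p (φ.map_target hu')
    rw [← hφ, φ.right_inv hu'] at hB'
    have hw : X (φ.symm u) 0 - X (φ.symm u) 3 ≠ 0 := sub_ne_zero.mpr hUX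
    refine ⟨(X (φ.symm u) 0 - X (φ.symm u) 3) ^ 2 * ρ (φ.symm u) -
      2 * (X (φ.symm u) 0 - X (φ.symm u) 3) * (N (φ.symm u) 0 - N (φ.symm u) 3), fun v w => ?_⟩
    have h := (fourthForm_eq hX hN hUX (B' v) (B' w)).symm.trans (hρ _ hUX (B' v) (B' w))
    simp only [T, I, II, III, hB' X hX.smooth, hB' N hN.smooth, Function.comp_apply]
    simp only [firstForm, secondForm] at h
    field_simp at h
    linear_combination h
  -- Written as cross products, proportionality is a closed condition and passes to the limit
  -- without any control of the factor `c`.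
  have hzero : ∀ v w v' w', T (φ p) v w * II (φ p) v' w' - T (φ p) v' w' * II (φ p) v w = 0 := by
    intro v w v' w'
    have hne : (𝓝[{u | φ.symm u ∈ gaussDomain X}] (φ p)).NeBot :=
      frequently_mem_iff_neBot.mp hfreq
    refine tendsto_nhds_unique ((((hT v w).mul (hII v' w')).sub
      ((hT v' w').mul (hII v w))).tendsto.mono_left
        (nhdsWithin_le_nhds (s := {u | φ.symm u ∈ gaussDomain X})))
      (tendsto_const_nhds.congr' ?_)
    filter_upwards [self_mem_nhdsWithin, nhdsWithin_le_nhds (φ.open_target.mem_nhds hu)]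
      with u hu1 hu2
    obtain ⟨c, hc⟩ := hprop u hu2 hu1
    simp only [Pi.sub_apply, Pi.mul_apply, hc]
    ring
  -- A vector with I(v₀, v₀) ≠ 0 is needed to solve the cross-product relation for II.
  obtain ⟨v₀, hv₀⟩ := hX.exists_timelike p
  refine humb p ⟨secondForm X N p v₀ v₀ / firstForm X p v₀ v₀, fun v w => ?_⟩
  have hn : (N p 0 - N p 3) ^ 2 ≠ 0 := pow_ne_zero 2 (sub_ne_zero.mpr hp)
  have h := hzero (B.symm v) (B.symm w) (B.symm v₀) (B.symm v₀)
  simp only [T, I, II, III, hB X hX.smooth, hB N hN.smooth, Function.comp_apply, hpp, hpX',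
    B.apply_symm_apply, sub_self] at h
  have h' : (N p 0 - N p 3) ^ 2 * (firstForm X p v w * secondForm X N p v₀ v₀ -
      firstForm X p v₀ v₀ * secondForm X N p v w) = 0 := by
    simp only [firstForm, secondForm]
    linear_combination h
  have h'' := (mul_eq_zero.mp h').resolve_left hn
  rw [div_mul_eq_mul_div, eq_div_iff hv₀.ne]
  linarith

/-- By the symmetry of (X₀ - X₃)² IV under exchanging X and N, the conformal factor is multiplied by
((X₀ - X₃) / (N₀ - N₃))². The inclusion of domains makes ρ available and smooth wherever the new
factor is required. -/
theorem HasConformalNormalGaussMap.swap (hX : IsTimelikeSurface X) (hN : IsUnitNormal X N)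
    (hNt : IsTimelikeSurface N) (humb : ∀ p, ¬ IsUmbilic X N p)
    (hc : HasConformalNormalGaussMap X N) :
    HasConformalNormalGaussMap N X := by
  have hsub := gaussDomain_normal_subset hX hN humb hc
  obtain ⟨ρ, hs, hρ⟩ := hc
  refine ⟨fun p => ((X p 0 - X p 3) / (N p 0 - N p 3)) ^ 2 * ρ p, ?_, fun p hp v w => ?_⟩
  · refine ContMDiffOn.mul (ContMDiffOn.pow ?_ 2) (hs.mono hsub)
    exact (contMDiff_apply_sub hX.smooth).contMDiffOn.div₀
      (contMDiff_apply_sub hN.smooth).contMDiffOn fun p hp => sub_ne_zero.mpr hp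
  · have hpX := hsub hp
    have h := (fourthForm_eq hX hN hpX v w).symm.trans (hρ p hpX v w)
    have hn : N p 0 - N p 3 ≠ 0 := sub_ne_zero.mpr hp
    have hx : X p 0 - X p 3 ≠ 0 := sub_ne_zero.mpr hpX
    change _ = ((X p 0 - X p 3) / (N p 0 - N p 3)) ^ 2 * ρ p * _
    rw [fourthForm_eq hNt (hX.isUnitNormal_swap hN) hp, secondForm_swap hX hN,
      mul_assoc (_ ^ 2), ← h]
    field_simp
    ring

end Conformal

end DeSitter

theorem theorem7p2 {M : Type*} [TopologicalSpace M] [ConnectedSpace M]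
    [ChartedSpace (EuclideanSpace ℝ (Fin 2)) M] [IsManifold (𝓡 2) ∞ M]
    (X N : M → DeSitter.L4)
    (hX : DeSitter.IsTimelikeSurface X)
    (hN : DeSitter.IsUnitNormal X N)
    (humb : ∀ p, ¬ DeSitter.IsUmbilic X N p)
    (hK : ∀ p, DeSitter.gaussCurvature X p ≠ 1) :
    DeSitter.IsTimelikeSurface N ∧ DeSitter.IsUnitNormal N X ∧
      (DeSitter.HasConformalNormalGaussMap X N ↔ DeSitter.HasConformalNormalGaussMap N X) := by
  have hNt := DeSitter.isTimelikeSurface_normal hX hN hK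
  have hXn := hX.isUnitNormal_swap hN
  have humb' : ∀ p, ¬ DeSitter.IsUmbilic N X p := fun p h =>
    humb p (DeSitter.isUmbilic_of_isUmbilic_normal hX hN p (hK p) h)
  exact ⟨hNt, hXn, .swap hX hN hNt humb, .swap hNt hXn hX humb'⟩
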